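/- Let $(M,\pi)$ be a Poisson manifold, let $\mathcal A=C^\infty(M)$ be the algebra of complex-valued smooth functions on $M$, and let $\{f,g\}=\pi(df,dg)$. Let $\star=\sum_r C_r\lambda^r$ and $\star'=\sum_r C'_r\lambda^r$ be (differential) star products on $M$ with $C_1(f,g)-C_1(g,f)=\{f,g\}$ and $C_1=C_1'$ (for instance $C_1=C_1'=\frac12\{\cdot,\cdot\}$). Let $L\to M$ be a complex line bundle, $\mathcal E=\Gamma^\infty(L)$, and let $(\mathcal E[[\lambda]],\bullet,\bullet')$ be a bimodule quantization of $L$ corresponding to $\star,\star'$. That is, there are bidifferential operators $R_r,R_r'$ with $R_0(s,f)=R_0'(f,s)=fs$ such that $s\bullet f=\sum_r R_r(s,f)\lambda^r$ makes $\mathcal E[[\lambda]]$ a right $(\mathcal A[[\lambda]],\star)$-module, $f\bullet' s=\sum_r R'_r(f,s)\lambda^r$ makes it a left $(\mathcal A[[\lambda]],\star')$-module, the two actions commute, and $\bullet'$ identifies $(\mathcal A[[\lambda]],\star')$ with the algebra of endomorphisms of the right module $(\mathcal E[[\lambda]],\bullet)$ (such data exist exactly when $\star'\in\Phi_L([\star])$).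 Put $R(s,f)=R_1(s,f)-R_1'(f,s)$ and $$\tau(f,g)=(C_2-C_2')(f,g)-(C_2-C_2')(g,f).$$ Write $\tilde\pi(\alpha)=\pi(\cdot,\alpha)$ and $[\alpha,\beta]=-\mathcal L_{\tilde\pi(\alpha)}\beta+\mathcal L_{\tilde\pi(\beta)}\alpha-d(\pi(\alpha,\beta))$ for one-forms $\alpha,\beta$. A contravariant connection on $L$ is a $\mathbb C$-bilinear map $(\alpha,s)\mapsto D_\alpha s$, $\Omega^1(M)\times\mathcal E\to\mathcal E$, with $D_{f\alpha}s=fD_\alpha s$ and $D_\alpha(fs)=fD_\alpha s+(\tilde\pi(\alpha)f)\,s$; its curvature is $\Theta_D(\alpha,\beta)s=D_\alpha D_\beta s-D_\beta D_\alpha s+D_{[\alpha,\beta]}s$. Then $R$ is a contravariant connection on $L$, in the sense that there is a contravariant connection $D$ with $D_{df}s=R(s,f)$ for all $f\in C^\infty(M)$ and $s\in\mathcal E$; and for every such $D$, writing $\Theta_R=\Theta_D$, $$\tau(f,g)\,s=-\,\Theta_R(df,dg)\,s\qquad\text{for all } f,g\in C^\infty(M),\ s\in\mathcal E .$$ -/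

import Mathlib

open scoped Manifold ContDiff

noncomputable section

/-! ### Smooth complex-valued functions and sections of complex line bundles -/

/-- Multiplication of complex numbers is smooth over `ℝ`, so that smooth complex-valued functions
on a real manifold form a ring. -/
instance complexContMDiffRing : ContMDiffRing 𝓘(ℝ, ℂ) ∞ ℂ :=
  { instNormedSpaceLieAddGroup with
    contMDiff_mul := by
      have h : ContDiff ℝ ∞ (fun p : ℂ × ℂ => p.1 * p.2) := contDiff_mul
      have h' := h.contMDiff
      rwa [modelWithCornersSelf_prod, ← chartedSpaceSelf_prod] at h' }

/-- `C^∞(M)`: the commutative ring of smooth complex-valued functions on the (real, boundaryless)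
manifold `M` of dimension `n`. -/
abbrev SmoothFun (n : ℕ) (M : Type*) [TopologicalSpace M]
    [ChartedSpace (EuclideanSpace ℝ (Fin n)) M] : Type _ :=
  C^∞⟮𝓡 n, M; 𝓘(ℝ, ℂ), ℂ⟯

/-- `Γ^∞(L)`: the smooth sections of `L`, a bundle with model fibre `ℂ`. -/
abbrev SmoothSec (n : ℕ) {M : Type*} [TopologicalSpace M]
    [ChartedSpace (EuclideanSpace ℝ (Fin n)) M]
    (L : M → Type*) [TopologicalSpace (Bundle.TotalSpace ℂ L)]
    [∀ x, TopologicalSpace (L x)] [FiberBundle ℂ L] : Type _ :=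
  Cₛ^∞⟮𝓡 n; ℂ, L⟯

section Instances

variable {n : ℕ} {M : Type*} [TopologicalSpace M] [ChartedSpace (EuclideanSpace ℝ (Fin n)) M]

/-- `C^∞(M)` is a `ℂ`-algebra through the constant functions. -/
instance smoothFunAlgebra : Algebra ℂ (SmoothFun n M) :=
  RingHom.toAlgebra
    { toFun := fun c => ⟨fun _ => c, contMDiff_const⟩
      map_one' := rfl
      map_mul' := fun _ _ => rfl
      map_zero' := rfl
      map_add' := fun _ _ => rfl }

variable {L : M → Type*} [TopologicalSpace (Bundle.TotalSpace ℂ L)]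
  [∀ x, AddCommGroup (L x)] [∀ x, Module ℂ (L x)] [∀ x, TopologicalSpace (L x)]
  [FiberBundle ℂ L] [VectorBundle ℂ ℂ L]

/-- The product of a smooth complex function and a smooth section of a complex line bundle is a
smooth section. -/
theorem contMDiff_complex_smul_section (f : SmoothFun n M) (s : SmoothSec n L) :
    ContMDiff (𝓡 n) ((𝓡 n).prod 𝓘(ℝ, ℂ)) ∞
      (fun x => (⟨x, f x • s x⟩ : Bundle.TotalSpace ℂ L)) := by
  intro x₀
  have hs := s.contMDiff x₀
  rw [Bundle.contMDiffAt_section] at hs ⊢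
  set e := trivializationAt ℂ L x₀
  have hf : ContMDiffAt (𝓡 n) 𝓘(ℝ, ℂ) ∞ (fun x => f x) x₀ := f.contMDiff x₀
  refine (hf.mul hs).congr_of_eventuallyEq ?_
  refine Filter.eventually_of_mem
    (e.open_baseSet.mem_nhds (FiberBundle.mem_baseSet_trivializationAt' x₀)) ?_
  intro x hx
  exact (e.linear ℂ hx).map_smul (f x) (s x)

variable [VectorBundle ℝ ℂ L]

/-- `Γ^∞(L)` is a module over `C^∞(M)` by pointwise multiplication. -/
instance smoothSecModule : Module (SmoothFun n M) (SmoothSec n L) where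
  smul f s := ⟨fun x => f x • s x, contMDiff_complex_smul_section f s⟩
  one_smul s := by ext x; exact one_smul ℂ (s x)
  mul_smul f g s := by ext x; exact mul_smul (f x) (g x) (s x)
  smul_zero f := by ext x; exact smul_zero (f x)
  smul_add f s t := by ext x; exact smul_add (f x) (s x) (t x)
  add_smul f g s := by ext x; exact add_smul (f x) (g x) (s x)
  zero_smul s := by ext x; exact zero_smul ℂ (s x)

/-- `Γ^∞(L)` is a complex vector space, a complex number acting as a constant function. -/
instance smoothSecComplexModule : Module ℂ (SmoothSec n L) :=
  Module.compHom (SmoothSec n L) (algebraMap ℂ (SmoothFun n M))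

instance smoothSecTower : IsScalarTower ℂ (SmoothFun n M) (SmoothSec n L) where
  smul_assoc c f s := by
    ext x
    exact mul_smul c (f x) (s x)

end Instances

/-! ### Cartan and Poisson calculus over a commutative `ℂ`-algebra

These notions are used for `A = C^∞(M)`. There `VectorField A` is the space of smooth sections of
the complexified tangent bundle (acting as derivations on smooth functions) and `OneForm A` is the
space of smooth complex one-forms on `M`. -/

/-- (Complex) vector fields, as derivations of the algebra of functions. -/
abbrev VectorField (A : Type*) [CommRing A] [Algebra ℂ A] : Type _ := Derivation ℂ A A

/-- (Complex) one-forms, as function-linear functionals on vector fields. -/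
abbrev OneForm (A : Type*) [CommRing A] [Algebra ℂ A] : Type _ := VectorField A →ₗ[A] A

section Poisson

variable {A : Type*} [CommRing A] [Algebra ℂ A]

/-- The differential `df` of a function, `df(Y) = Y(f)`. -/
def extd (f : A) : OneForm A where
  toFun Y := Y f
  map_add' _ _ := rfl
  map_smul' _ _ := rfl

/-- The Lie derivative of a one-form, `(𝓛_X β)(Y) = X(β(Y)) - β([X, Y])`. -/
def lieDerivOneForm (X : VectorField A) (β : OneForm A) : OneForm A where
  toFun Y := X (β Y) - β ⁅X, Y⁆
  map_add' Y Z := by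
    rw [lie_add]
    simp only [map_add]
    ring
  map_smul' g Y := by
    have h : ⁅X, g • Y⁆ = (X g) • Y + g • ⁅X, Y⁆ := by
      ext a
      simp only [Derivation.commutator_apply, Derivation.smul_apply, Derivation.add_apply,
        smul_eq_mul, Derivation.leibniz]
      ring
    rw [h]
    simp only [map_add, map_smul, smul_eq_mul, Derivation.leibniz, RingHom.id_apply]
    ring

/-- A Poisson tensor `π`. The bivector field `π` is given through its bundle morphism
`π̃ : T^*M → TM`, `α ↦ π(·, α)`, so that `π(β, α) = β(π̃ α)`. The integrability `[π, π] = 0` is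
expressed by the Jacobi identity of the bracket `{f, g} = π(df, dg)`. -/
structure PoissonTensor (A : Type*) [CommRing A] [Algebra ℂ A] where
  /-- The map `π̃ : α ↦ π(·, α)`. -/
  sharp : OneForm A →ₗ[A] VectorField A
  skew : ∀ α : OneForm A, α (sharp α) = 0
  jacobi : ∀ f g h : A,
    extd f (sharp (extd (extd g (sharp (extd h))))) +
      extd g (sharp (extd (extd h (sharp (extd f))))) +
      extd h (sharp (extd (extd f (sharp (extd g))))) = 0

namespace PoissonTensor

variable (π : PoissonTensor A)

/-- `π(α, β)`. -/
def pairing (α β : OneForm A) : A := α (π.sharp β)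

/-- The Poisson bracket `{f, g} = π(df, dg)`. -/
def bracket (f g : A) : A := π.pairing (extd f) (extd g)

/-- The bracket on one-forms
`[α, β] = -𝓛_{π̃ α} β + 𝓛_{π̃ β} α - d(π(α, β))`. -/
def formBracket (α β : OneForm A) : OneForm A :=
  -lieDerivOneForm (π.sharp α) β + lieDerivOneForm (π.sharp β) α - extd (π.pairing α β)

end PoissonTensor

/-- A contravariant connection on the module of sections `P`, with respect to `π`:
`D_{f α} s = f D_α s` and `D_α (f s) = f D_α s + (π̃ α)(f) s`. For `α = dg` the last term is
`X_g(f) s = {f, g} s`, in accordance with `D_{dg} = ∇_{X_g}` for an ordinary connection `∇`. -/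
structure ContravariantConnection (π : PoissonTensor A) (P : Type*) [AddCommGroup P]
    [Module ℂ P] [Module A P] where
  /-- `D α s` is `D_α s`. -/
  D : OneForm A →ₗ[ℂ] P →ₗ[ℂ] P
  smul_form : ∀ (f : A) (α : OneForm A) (s : P), D (f • α) s = f • D α s
  leibniz : ∀ (α : OneForm A) (f : A) (s : P), D α (f • s) = f • D α s + (π.sharp α f) • s

/-- The curvature `Θ_D(α, β) s = D_α D_β s - D_β D_α s + D_{[α, β]} s`. -/
def ContravariantConnection.curvature {π : PoissonTensor A} {P : Type*} [AddCommGroup P]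
    [Module ℂ P] [Module A P] (D : ContravariantConnection π P) (α β : OneForm A) (s : P) : P :=
  D.D α (D.D β s) - D.D β (D.D α s) + D.D (π.formBracket α β) s

end Poisson

/-! ### Bidifferential operators -/

/-- `T : P → Q` (a `ℂ`-linear map between modules over the algebra `A` of smooth functions) is a
differential operator of order at most `k`: it is function-linear for `k = 0`, and all commutators
`[T, a]` with functions `a` have order at most `k` when `T` has order at most `k + 1`. -/
def HasDiffOrderLE (A : Type*) [CommRing A] {P Q : Type*} [AddCommGroup P] [Module A P]
    [AddCommGroup Q] [Module A Q] : ℕ → (P → Q) → Prop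
  | 0, T => ∀ (a : A) (p : P), T (a • p) = a • T p
  | k + 1, T => ∀ a : A, HasDiffOrderLE A k (fun p => T (a • p) - a • T p)

/-- `B` is a bidifferential operator: near every point `x` of `M` (that is, after multiplication by
a function `χ` with `χ x ≠ 0`) it is a differential operator of some finite order `k` in each of the
two arguments. -/
def IsBidifferential {n : ℕ} {M : Type*} [TopologicalSpace M]
    [ChartedSpace (EuclideanSpace ℝ (Fin n)) M] {P Q R : Type*}
    [AddCommGroup P] [Module ℂ P] [Module (SmoothFun n M) P]
    [AddCommGroup Q] [Module ℂ Q] [Module (SmoothFun n M) Q]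
    [AddCommGroup R] [Module ℂ R] [Module (SmoothFun n M) R]
    (B : P →ₗ[ℂ] Q →ₗ[ℂ] R) : Prop :=
  ∀ x : M, ∃ χ : SmoothFun n M, χ x ≠ 0 ∧ ∃ k : ℕ,
    (∀ q : Q, HasDiffOrderLE (SmoothFun n M) k (fun p => χ • B p q)) ∧
    (∀ p : P, HasDiffOrderLE (SmoothFun n M) k (fun q => χ • B p q))

/-! ### Formal power series, star products, bimodule quantizations -/

/-- `P[[λ]]`: a formal power series `∑ p_r λ^r` is the sequence of its coefficients. -/
abbrev FormalSeries (P : Type*) : Type _ := ℕ → P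

/-- The `ℂ[[λ]]`-bilinear map `P[[λ]] × Q[[λ]] → R[[λ]]` given by `∑_r B_r λ^r`. -/
def formalBilin {P Q R : Type*} [AddCommGroup P] [Module ℂ P] [AddCommGroup Q] [Module ℂ Q]
    [AddCommGroup R] [Module ℂ R] (B : ℕ → P →ₗ[ℂ] Q →ₗ[ℂ] R)
    (p : FormalSeries P) (q : FormalSeries Q) : FormalSeries R := fun N =>
  ∑ a ∈ Finset.HasAntidiagonal.antidiagonal N, ∑ b ∈ Finset.HasAntidiagonal.antidiagonal a.2, B a.1 (p b.1) (q b.2)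

/-- A star product `f ⋆ g = ∑_r C_r(f, g) λ^r` on `M`. -/
structure StarProduct (n : ℕ) (M : Type*) [TopologicalSpace M]
    [ChartedSpace (EuclideanSpace ℝ (Fin n)) M] where
  /-- The coefficient maps `C_r`. -/
  C : ℕ → SmoothFun n M →ₗ[ℂ] SmoothFun n M →ₗ[ℂ] SmoothFun n M
  C_zero : ∀ f g, C 0 f g = f * g
  bidifferential : ∀ r, IsBidifferential (n := n) (M := M) (C r)
  assoc : ∀ F G H : FormalSeries (SmoothFun n M),
    formalBilin C (formalBilin C F G) H = formalBilin C F (formalBilin C G H)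

section Quantization

variable {n : ℕ} {M : Type*} [TopologicalSpace M] [ChartedSpace (EuclideanSpace ℝ (Fin n)) M]

/-- `τ(f, g) = (C₂ - C₂')(f, g) - (C₂ - C₂')(g, f)`. -/
def StarProduct.tau (S S' : StarProduct n M) (f g : SmoothFun n M) : SmoothFun n M :=
  (S.C 2 f g - S'.C 2 f g) - (S.C 2 g f - S'.C 2 g f)

/-- A deformation quantization of the line bundle `L` with respect to the star product `S`:
bidifferential operators `R_r` with `R_0(s, f) = s f` such that `s • f = ∑_r R_r(s, f) λ^r` makes
`Γ^∞(L)[[λ]]` a right module over `(C^∞(M)[[λ]], S)`. -/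
structure DeformationQuantization (L : M → Type*) [TopologicalSpace (Bundle.TotalSpace ℂ L)]
    [∀ x, AddCommGroup (L x)] [∀ x, Module ℂ (L x)] [∀ x, TopologicalSpace (L x)]
    [FiberBundle ℂ L] [VectorBundle ℝ ℂ L] [VectorBundle ℂ ℂ L] (S : StarProduct n M) where
  /-- The coefficient maps `R_r` of the right action `•`. -/
  Rr : ℕ → SmoothSec n L →ₗ[ℂ] SmoothFun n M →ₗ[ℂ] SmoothSec n L
  Rr_zero : ∀ s f, Rr 0 s f = f • s
  Rr_bidifferential : ∀ r, IsBidifferential (n := n) (M := M) (Rr r)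
  right_assoc : ∀ (s : FormalSeries (SmoothSec n L)) (F G : FormalSeries (SmoothFun n M)),
    formalBilin Rr s (formalBilin S.C F G) = formalBilin Rr (formalBilin Rr s F) G

/-- A bimodule quantization `(Γ^∞(L)[[λ]], •, •')` of `L` corresponding to the star products `S`
and `S'`: a deformation quantization `•` of `L` with respect to `S`, and a left action
`f •' s = ∑_r R_r'(f, s) λ^r` of `(C^∞(M)[[λ]], S')` with bidifferential `R_r'` and
`R_0'(f, s) = f s`, which identifies `(C^∞(M)[[λ]], S')` with the algebra of endomorphisms of the
right module `(Γ^∞(L)[[λ]], •)`. That such data exist is the meaning of `S' ∈ Φ_L([S])`. -/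
structure BimoduleQuantization (L : M → Type*) [TopologicalSpace (Bundle.TotalSpace ℂ L)]
    [∀ x, AddCommGroup (L x)] [∀ x, Module ℂ (L x)] [∀ x, TopologicalSpace (L x)]
    [FiberBundle ℂ L] [VectorBundle ℝ ℂ L] [VectorBundle ℂ ℂ L] (S S' : StarProduct n M) extends
    DeformationQuantization L S where
  /-- The coefficient maps `R_r'` of the left action `•'`. -/
  Rl : ℕ → SmoothFun n M →ₗ[ℂ] SmoothSec n L →ₗ[ℂ] SmoothSec n L
  Rl_zero : ∀ f s, Rl 0 f s = f • s
  Rl_bidifferential : ∀ r, IsBidifferential (n := n) (M := M) (Rl r)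
  left_assoc : ∀ (F G : FormalSeries (SmoothFun n M)) (s : FormalSeries (SmoothSec n L)),
    formalBilin Rl (formalBilin S'.C F G) s = formalBilin Rl F (formalBilin Rl G s)
  bimodule : ∀ (F : FormalSeries (SmoothFun n M)) (s : FormalSeries (SmoothSec n L))
    (G : FormalSeries (SmoothFun n M)),
    formalBilin Rr (formalBilin Rl F s) G = formalBilin Rl F (formalBilin Rr s G)
  bijective_end : ∀ φ : FormalSeries (SmoothSec n L) →+ FormalSeries (SmoothSec n L),
    (∀ s G, φ (formalBilin Rr s G) = formalBilin Rr (φ s) G) →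
    ∃! F : FormalSeries (SmoothFun n M), ∀ s, φ s = formalBilin Rl F s

/-- The semiclassical limit `R(s, f) = R_1(s, f) - R_1'(f, s)` of a bimodule quantization. -/
def BimoduleQuantization.R {L : M → Type*} [TopologicalSpace (Bundle.TotalSpace ℂ L)]
    [∀ x, AddCommGroup (L x)] [∀ x, Module ℂ (L x)] [∀ x, TopologicalSpace (L x)]
    [FiberBundle ℂ L] [VectorBundle ℝ ℂ L] [VectorBundle ℂ ℂ L] {S S' : StarProduct n M}
    (Q : BimoduleQuantization L S S') (s : SmoothSec n L) (f : SmoothFun n M) : SmoothSec n L :=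
  Q.Rr 1 s f - Q.Rl 1 f s

end Quantization

end

/-! Comparing coefficients of `λ` and `λ²` in the two module laws and in the compatibility of the
two actions, evaluated on constant series, gives three identities of each order.

In first order they show that `f ↦ R(s, f)` is a derivation with values in the sections
(`BimoduleQuantization.R_mul`, which needs `C₁ = C₁'`) and that `R(f s, g) = f R(s, g) + {f, g} s`
(`BimoduleQuantization.R_smul`). To pass from such a derivation to a map defined on all one-forms,
recall that a one-form `α` is a functional on scalar derivations. If `φ` is a function-linear
functional on sections, `φ ∘ R(s, ·)` is a scalar derivation, and `φ ↦ α(φ ∘ R(s, ·))` is an element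
of the double dual of the module of sections. That module is reflexive (`smoothSec_isReflexive`: a
local frame and its coordinate, cut off by a bump function, reduce this to gluing), so the
functional is the evaluation at a unique section, which is `D_α s`
(`ContravariantConnection.exists_of_derivation`).

In second order, antisymmetrize the two module laws in `f, g` and subtract them. The compatibility
of the actions eliminates the second order operators, and what remains is
`τ(f, g) s = R(R(s, f), g) - R(R(s, g), f) - R(s, {f, g})` (`BimoduleQuantization.tau_smul`). Since
`[df, dg] = d{f, g}` in the convention used here, the right hand side is `-Θ(df, dg) s`. -/

/-! ### Formal bilinear maps on constant series -/

section FormalBilin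

variable {P Q R : Type*} [AddCommGroup P] [Module ℂ P] [AddCommGroup Q] [Module ℂ Q]
  [AddCommGroup R] [Module ℂ R]

theorem formalBilin_single_right (B : ℕ → P →ₗ[ℂ] Q →ₗ[ℂ] R) (p : FormalSeries P) (q : Q)
    (N : ℕ) :
    formalBilin B p (Pi.single 0 q) N =
      ∑ a ∈ Finset.HasAntidiagonal.antidiagonal N, B a.1 (p a.2) q := by
  refine Finset.sum_congr rfl fun a _ => ?_
  rw [Finset.sum_eq_single (a.2, 0)]
  · simp
  · rintro ⟨i, j⟩ hb hne
    have hj : j ≠ 0 := by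
      rintro rfl
      simp_all
    simp [Pi.single_eq_of_ne hj]
  · simp

theorem formalBilin_single_left (B : ℕ → P →ₗ[ℂ] Q →ₗ[ℂ] R) (p : P) (q : FormalSeries Q)
    (N : ℕ) :
    formalBilin B (Pi.single 0 p) q N =
      ∑ a ∈ Finset.HasAntidiagonal.antidiagonal N, B a.1 p (q a.2) := by
  refine Finset.sum_congr rfl fun a _ => ?_
  rw [Finset.sum_eq_single (0, a.2)]
  · simp
  · rintro ⟨i, j⟩ hb hne
    have hi : i ≠ 0 := by
      rintro rfl
      simp_all
    simp [Pi.single_eq_of_ne hi]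
  · simp

theorem formalBilin_single_single (B : ℕ → P →ₗ[ℂ] Q →ₗ[ℂ] R) (p : P) (q : Q) :
    formalBilin B (Pi.single 0 p) (Pi.single 0 q) = fun N => B N p q := by
  funext N
  rw [formalBilin_single_right, Finset.sum_eq_single (N, 0)]
  · simp
  · rintro ⟨i, j⟩ hb hne
    have hj : j ≠ 0 := by
      rintro rfl
      simp_all
    simp [Pi.single_eq_of_ne hj]
  · simp

end FormalBilin

/-! ### Sections of a line bundle form a reflexive module -/

section Reflexive

variable {n : ℕ} {M : Type*} [TopologicalSpace M] [ChartedSpace (EuclideanSpace ℝ (Fin n)) M]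
  [T2Space M]

/-- Smooth cutoff functions with values in `ℂ`. -/
theorem exists_smoothFun_cutoff [IsManifold (𝓡 n) ∞ M] {U : Set M} {x : M} (hU : U ∈ nhds x) :
    ∃ χ : SmoothFun n M, (∀ᶠ y in nhds x, χ y = 1) ∧ tsupport χ ⊆ U := by
  obtain ⟨f, -, hf⟩ := (SmoothBumpFunction.nhds_basis_tsupport (I := 𝓡 n) x).mem_iff.1 hU
  have hsm : ContMDiff (𝓡 n) 𝓘(ℝ, ℂ) ∞ (Complex.ofRealCLM ∘ f) :=
    Complex.ofRealCLM.contDiff.contMDiff.comp f.contMDiff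
  refine ⟨⟨Complex.ofRealCLM ∘ f, hsm⟩, ?_, ?_⟩
  · filter_upwards [f.eventuallyEq_one] with y hy
    change ((f y : ℝ) : ℂ) = 1
    rw [hy, Pi.one_apply, Complex.ofReal_one]
  · have hsupp : Function.support (Complex.ofRealCLM ∘ f) ⊆ Function.support f := by
      intro y hy h
      refine hy ?_
      change ((f y : ℝ) : ℂ) = 0
      rw [h, Complex.ofReal_zero]
    exact (closure_mono hsupp).trans hf

variable {L : M → Type*} [TopologicalSpace (Bundle.TotalSpace ℂ L)]
  [∀ x, AddCommGroup (L x)] [∀ x, Module ℂ (L x)] [∀ x, TopologicalSpace (L x)]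
  [FiberBundle ℂ L] [VectorBundle ℝ ℂ L] [VectorBundle ℂ ℂ L]

omit [T2Space M] in
@[simp]
theorem smoothSec_smul_apply (f : SmoothFun n M) (s : SmoothSec n L) (x : M) :
    (f • s) x = f x • s x := rfl

/-- Near every point a line bundle has a dual basis of length one, up to a cutoff: a section `e`
and a function-linear functional `ψ` on sections with `ψ(s) e = ρ s`, where `ρ = 1` near `x`. -/
theorem exists_cutoff_local_frame [IsManifold (𝓡 n) ∞ M] [ContMDiffVectorBundle ∞ ℂ L (𝓡 n)]
    (x : M) :
    ∃ (ρ : SmoothFun n M) (e : SmoothSec n L)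
      (ψ : Module.Dual (SmoothFun n M) (SmoothSec n L)),
      (∀ᶠ y in nhds x, ρ y = 1) ∧ ∀ s, ψ s • e = ρ • s := by
  set t := trivializationAt ℂ L x
  have hx : t.baseSet ∈ nhds x :=
    t.open_baseSet.mem_nhds (FiberBundle.mem_baseSet_trivializationAt' x)
  obtain ⟨χ, hχ1, hχ⟩ := exists_smoothFun_cutoff (n := n) hx
  have hzero : ∀ y ∉ t.baseSet, χ y = 0 := fun y hy =>
    image_eq_zero_of_notMem_tsupport fun h => hy (hχ h)
  -- The cut-off local frame and the cut-off coordinate in the trivialization.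
  have he : ContMDiff (𝓡 n) ((𝓡 n).prod 𝓘(ℝ, ℂ)) ∞
      (fun y => (⟨y, χ y • t.symm y (1 : ℂ)⟩ : Bundle.TotalSpace ℂ L)) := by
    intro y
    by_cases hy : y ∈ tsupport χ
    · rw [t.contMDiffAt_section_iff (hχ hy)]
      refine (χ.contMDiff y).congr_of_eventuallyEq ?_
      filter_upwards [t.open_baseSet.mem_nhds (hχ hy)] with z hz
      refine ((t.linear ℂ hz).map_smul (χ z) _).trans ?_
      rw [t.apply_mk_symm hz, smul_eq_mul, mul_one]
    · refine (Bundle.contMDiff_zeroSection ℝ L y).congr_of_eventuallyEq ?_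
      filter_upwards [(isClosed_tsupport χ).isOpen_compl.mem_nhds hy] with z hz
      rw [image_eq_zero_of_notMem_tsupport hz, zero_smul]
      rfl
  have hψ : ∀ s : SmoothSec n L,
      ContMDiff (𝓡 n) 𝓘(ℝ, ℂ) ∞ (fun y => χ y * (t ⟨y, s y⟩).2) := by
    intro s y
    by_cases hy : y ∈ tsupport χ
    · exact (χ.contMDiff y).mul ((t.contMDiffAt_section_iff (hχ hy)).1 (s.contMDiff y))
    · refine contMDiffAt_const (c := (0 : ℂ)) |>.congr_of_eventuallyEq ?_
      filter_upwards [(isClosed_tsupport χ).isOpen_compl.mem_nhds hy] with z hz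
      rw [image_eq_zero_of_notMem_tsupport hz, zero_mul]
  refine ⟨χ * χ, ⟨fun y => χ y • t.symm y (1 : ℂ), he⟩,
    { toFun := fun s => ⟨fun y => χ y * (t ⟨y, s y⟩).2, hψ s⟩
      map_add' := fun s s' => ?_
      map_smul' := fun f s => ?_ }, ?_, fun s => ?_⟩
  · ext y
    by_cases hy : y ∈ t.baseSet
    · exact (congrArg (χ y * ·) ((t.linear ℂ hy).map_add (s y) (s' y))).trans (mul_add _ _ _)
    · change χ y * _ = χ y * _ + χ y * _
      rw [hzero y hy, zero_mul, zero_mul, zero_mul, add_zero]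
  · ext y
    by_cases hy : y ∈ t.baseSet
    · exact (congrArg (χ y * ·) ((t.linear ℂ hy).map_smul (f y) (s y))).trans
        (mul_left_comm _ _ _)
    · change χ y * _ = f y * (χ y * _)
      rw [hzero y hy, zero_mul, zero_mul, mul_zero]
  · filter_upwards [hχ1] with y hy
    simp [hy]
  · ext y
    change (χ y * (t ⟨y, s y⟩).2) • χ y • t.symm y (1 : ℂ) = (χ y * χ y) • s y
    by_cases hy : y ∈ t.baseSet
    · have h : (t ⟨y, s y⟩).2 • t.symm y (1 : ℂ) = s y := by
        have h' := (t.symmₗ ℂ y).map_smul (t ⟨y, s y⟩).2 1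
        rw [smul_eq_mul, mul_one, t.symmₗ_apply hy, t.symmₗ_apply hy,
          t.symm_apply_apply_mk hy] at h'
        exact h'.symm
      rw [mul_smul, smul_comm (t ⟨y, s y⟩).2, h, mul_smul]
    · simp [hzero y hy]

/-- The sections of a line bundle form a reflexive module over the smooth functions.
Near each point `x` a section `t` is recovered as `ψ(t) e` from the pair `(e, ψ)` of
`exists_cutoff_local_frame`; a functional `Φ` on the dual module is therefore the evaluation at
the section `t` with `t(x) = Φ(ψ_x)(x) e_x(x)`. -/
theorem smoothSec_isReflexive [IsManifold (𝓡 n) ∞ M] [ContMDiffVectorBundle ∞ ℂ L (𝓡 n)] :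
    Module.IsReflexive (SmoothFun n M) (SmoothSec n L) := by
  choose ρ e ψ hρ hψ using exists_cutoff_local_frame (n := n) (L := L)
  have hρ1 : ∀ x, ρ x x = 1 := fun x => (hρ x).self_of_nhds
  refine ⟨⟨fun s s' h => ?_, fun Φ => ?_⟩⟩
  · ext x
    have h1 : ρ x • s = ρ x • s' := by
      rw [← hψ, ← hψ, show ψ x s = ψ x s' from LinearMap.congr_fun h (ψ x)]
    simpa [hρ1] using congrArg (fun s : SmoothSec n L => s x) h1
  · -- Both sides are `Φ` applied to the identity of functionals `ρ_x φ = φ(e_x) ψ_x`.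
    have key : ∀ (x : M) (φ : Module.Dual (SmoothFun n M) (SmoothSec n L)),
        ρ x * Φ φ = φ (e x) * Φ (ψ x) := by
      intro x φ
      rw [← smul_eq_mul, ← smul_eq_mul, ← map_smul, ← map_smul]
      congr 1
      ext1 s
      rw [LinearMap.smul_apply, LinearMap.smul_apply, ← map_smul, ← hψ, map_smul, smul_eq_mul,
        smul_eq_mul, mul_comm]
    -- The local candidates `Φ(ψ_x) e_x` agree with the pointwise one up to the cutoff.
    have glue : ∀ x y : M,
        ρ x y • (Φ (ψ y) y • e y y) = (Φ (ψ x) • e x) y := by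
      intro x y
      have h1 := congrArg (fun f : SmoothFun n M => f y) (key x (ψ y))
      have h2 := congrArg (fun s : SmoothSec n L => s y) (hψ y (e x))
      simp only [ContMDiffMap.coe_mul, Pi.mul_apply, smoothSec_smul_apply, hρ1, one_smul] at h1 h2
      rw [smul_smul, h1, smoothSec_smul_apply, ← h2, smul_smul, mul_comm]
    have hsmooth : ContMDiff (𝓡 n) ((𝓡 n).prod 𝓘(ℝ, ℂ)) ∞
        (fun y => (⟨y, Φ (ψ y) y • e y y⟩ : Bundle.TotalSpace ℂ L)) := by
      intro x
      refine ((Φ (ψ x) • e x).contMDiff x).congr_of_eventuallyEq ?_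
      filter_upwards [hρ x] with y hy
      rw [← glue x y, hy, one_smul]
    refine ⟨⟨fun y => Φ (ψ y) y • e y y, hsmooth⟩, LinearMap.ext fun φ => ?_⟩
    ext x
    have h1 : ρ x • (⟨fun y => Φ (ψ y) y • e y y, hsmooth⟩ : SmoothSec n L) =
        Φ (ψ x) • e x := by
      ext y
      exact glue x y
    have h2 := congrArg (fun f : SmoothFun n M => f x) (congrArg φ h1)
    have h3 := congrArg (fun f : SmoothFun n M => f x) (key x φ)
    simp only [map_smul, smul_eq_mul, ContMDiffMap.coe_mul, Pi.mul_apply, hρ1, one_mul] at h2 h3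
    rw [Module.Dual.eval_apply, h2, h3, mul_comm]

end Reflexive

/-! ### Contravariant connections from derivations -/

section Algebraic

variable {A : Type*} [CommRing A] [Algebra ℂ A] {P : Type*} [AddCommGroup P] [Module ℂ P]
  [Module A P] [IsScalarTower ℂ A P]

/-- The contraction of a one-form `α` with a derivation `δ` of functions with values in a reflexive
module `P`: the element `α(δ)` of `P` with `φ(α(δ)) = α(φ ∘ δ)` for all functionals `φ` on `P`. -/
noncomputable def OneForm.contract [Module.IsReflexive A P] (α : OneForm A)
    (δ : Derivation ℂ A P) : P :=
  (Module.evalEquiv A P).symm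
    { toFun := fun φ => α (φ.compDer δ)
      map_add' := fun φ φ' => by
        rw [← map_add]
        rfl
      map_smul' := fun f φ => by
        rw [RingHom.id_apply, ← map_smul]
        rfl }

omit [Algebra ℂ A] [Module ℂ P] [IsScalarTower ℂ A P] in
theorem Module.IsReflexive.ext_dual [Module.IsReflexive A P] {p q : P}
    (h : ∀ φ : Module.Dual A P, φ p = φ q) : p = q :=
  (Module.bijective_dual_eval A P).1 (LinearMap.ext h)

namespace OneForm

variable [Module.IsReflexive A P]

@[simp]
theorem dual_apply_contract (φ : Module.Dual A P) (α : OneForm A) (δ : Derivation ℂ A P) :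
    φ (α.contract δ) = α (φ.compDer δ) :=
  Module.apply_evalEquiv_symm_apply A P φ _

theorem contract_add_left (α β : OneForm A) (δ : Derivation ℂ A P) :
    (α + β).contract δ = α.contract δ + β.contract δ :=
  Module.IsReflexive.ext_dual (A := A) fun φ => by simp

theorem contract_smul_left (f : A) (α : OneForm A) (δ : Derivation ℂ A P) :
    (f • α).contract δ = f • α.contract δ :=
  Module.IsReflexive.ext_dual (A := A) fun φ => by simp

theorem contract_add_right (α : OneForm A) (δ ε : Derivation ℂ A P) :
    α.contract (δ + ε) = α.contract δ + α.contract ε :=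
  Module.IsReflexive.ext_dual (A := A) fun φ => by simp

theorem contract_extd (f : A) (δ : Derivation ℂ A P) : (extd f).contract δ = δ f :=
  Module.IsReflexive.ext_dual (A := A) fun φ => by
    rw [dual_apply_contract]
    rfl

end OneForm

namespace PoissonTensor

variable (π : PoissonTensor A)

theorem apply_sharp_swap (α β : OneForm A) : α (π.sharp β) = -β (π.sharp α) := by
  have h := π.skew (α + β)
  simp only [map_add, LinearMap.add_apply, π.skew, zero_add, add_zero] at h
  exact eq_neg_of_add_eq_zero_left ((add_comm _ _).trans h)

theorem bracket_eq_sharp_extd (f g : A) : π.bracket f g = π.sharp (extd g) f := rfl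

theorem bracket_swap (f g : A) : π.bracket f g = -π.bracket g f :=
  π.apply_sharp_swap _ _

/-- With the sign conventions of `formBracket`, `[df, dg] = d{f, g}`. -/
theorem formBracket_extd (f g : A) :
    π.formBracket (extd f) (extd g) = extd (π.bracket f g) := by
  have hL : ∀ (X : VectorField A) (h : A), lieDerivOneForm X (extd h) = extd (X h) := by
    intro X h
    ext Y
    change X (Y h) - ⁅X, Y⁆ h = Y (X h)
    rw [Derivation.commutator_apply, sub_sub_cancel]
  have hneg : extd (-π.bracket f g) = -extd (π.bracket f g) := by
    ext Y
    exact map_neg Y _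
  rw [formBracket, hL, hL, ← π.bracket_eq_sharp_extd, ← π.bracket_eq_sharp_extd,
    π.bracket_swap g f, hneg]
  change - -extd (π.bracket f g) + extd (π.bracket f g) - extd (π.bracket f g) = _
  abel

end PoissonTensor

omit [IsScalarTower ℂ A P] in
theorem ContravariantConnection.curvature_extd {π : PoissonTensor A}
    (D : ContravariantConnection π P) (f g : A) (s : P) :
    D.curvature (extd f) (extd g) s =
      D.D (extd f) (D.D (extd g) s) - D.D (extd g) (D.D (extd f) s) +
        D.D (extd (π.bracket f g)) s := by
  rw [curvature, π.formBracket_extd]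

/-- A map `δ` sending `s` to a `P`-valued derivation `f ↦ δ s f`, with
`δ (f s) g = f (δ s g) + {f, g} s`, comes from a contravariant connection when `P` is reflexive:
`D_α s` is the contraction of `α` with `δ s`. -/
theorem ContravariantConnection.exists_of_derivation [Module.IsReflexive A P]
    (π : PoissonTensor A) (δ : P →+ Derivation ℂ A P)
    (hδ : ∀ (f : A) (s : P) (g : A), δ (f • s) g = f • δ s g + π.bracket f g • s) :
    ∃ D : ContravariantConnection π P, ∀ s f, D.D (extd f) s = δ s f := by
  have hleib : ∀ (α : OneForm A) (f : A) (s : P),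
      α.contract (δ (f • s)) = f • α.contract (δ s) + (π.sharp α f) • s := by
    refine fun α f s => Module.IsReflexive.ext_dual (A := A) fun φ => ?_
    -- Composed with `φ`, the correction term of `hδ` is a multiple of the vector field `-π̃(df)`.
    have h : φ.compDer (δ (f • s)) = f • φ.compDer (δ s) - φ s • π.sharp (extd f) := by
      ext g
      change φ (δ (f • s) g) = f * φ (δ s g) - φ s * π.sharp (extd f) g
      rw [hδ, map_add, map_smul, map_smul, π.bracket_swap, π.bracket_eq_sharp_extd, smul_eq_mul,
        smul_eq_mul]
      ring
    have h' : α (π.sharp (extd f)) = -π.sharp α f := π.apply_sharp_swap α (extd f)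
    rw [OneForm.dual_apply_contract, h, map_sub, map_smul, map_smul, h', map_add, map_smul,
      map_smul, OneForm.dual_apply_contract]
    simp only [smul_eq_mul]
    ring
  refine ⟨{ D := LinearMap.mk₂ ℂ (fun α s => α.contract (δ s)) ?_ ?_ ?_ ?_
            smul_form := fun f α s => α.contract_smul_left f _
            leibniz := hleib }, fun s f => OneForm.contract_extd f _⟩
  · exact fun α β s => OneForm.contract_add_left α β _
  · intro c α s
    rw [← algebraMap_smul A c α, OneForm.contract_smul_left, algebraMap_smul]
  · intro α s t
    rw [map_add, OneForm.contract_add_right]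
  · intro c α s
    rw [← algebraMap_smul A c s, hleib, Derivation.map_algebraMap, zero_smul, add_zero,
      algebraMap_smul]

end Algebraic

/-! ### The module identities up to second order -/

section Quantization

variable {n : ℕ} {M : Type*} [TopologicalSpace M] [ChartedSpace (EuclideanSpace ℝ (Fin n)) M]
  {L : M → Type*} [TopologicalSpace (Bundle.TotalSpace ℂ L)]
  [∀ x, AddCommGroup (L x)] [∀ x, Module ℂ (L x)] [∀ x, TopologicalSpace (L x)]
  [FiberBundle ℂ L] [VectorBundle ℝ ℂ L] [VectorBundle ℂ ℂ L] {S S' : StarProduct n M}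

namespace DeformationQuantization

variable (Q : DeformationQuantization L S) (f g : SmoothFun n M) (s : SmoothSec n L)

theorem right_assoc_coeff (N : ℕ) :
    ∑ a ∈ Finset.HasAntidiagonal.antidiagonal N, Q.Rr a.1 s (S.C a.2 f g) =
      ∑ a ∈ Finset.HasAntidiagonal.antidiagonal N, Q.Rr a.1 (Q.Rr a.2 s f) g := by
  have h := congrFun (Q.right_assoc (Pi.single 0 s) (Pi.single 0 f) (Pi.single 0 g)) N
  rwa [formalBilin_single_single, formalBilin_single_single, formalBilin_single_left,
    formalBilin_single_right] at h

theorem right_assoc_one :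
    S.C 1 f g • s + Q.Rr 1 s (f * g) = g • Q.Rr 1 s f + Q.Rr 1 (f • s) g := by
  simpa [Finset.Nat.antidiagonal_succ, Q.Rr_zero, S.C_zero] using Q.right_assoc_coeff f g s 1

theorem right_assoc_two :
    S.C 2 f g • s + (Q.Rr 1 s (S.C 1 f g) + Q.Rr 2 s (f * g)) =
      g • Q.Rr 2 s f + (Q.Rr 1 (Q.Rr 1 s f) g + Q.Rr 2 (f • s) g) := by
  simpa [Finset.Nat.antidiagonal_succ, Q.Rr_zero, S.C_zero] using Q.right_assoc_coeff f g s 2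

end DeformationQuantization

namespace BimoduleQuantization

variable (Q : BimoduleQuantization L S S') (f g : SmoothFun n M) (s : SmoothSec n L)

theorem left_assoc_coeff (N : ℕ) :
    ∑ a ∈ Finset.HasAntidiagonal.antidiagonal N, Q.Rl a.1 (S'.C a.2 f g) s =
      ∑ a ∈ Finset.HasAntidiagonal.antidiagonal N, Q.Rl a.1 f (Q.Rl a.2 g s) := by
  have h := congrFun (Q.left_assoc (Pi.single 0 f) (Pi.single 0 g) (Pi.single 0 s)) N
  rwa [formalBilin_single_single, formalBilin_single_single, formalBilin_single_left,
    formalBilin_single_right] at h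

theorem left_assoc_one :
    S'.C 1 f g • s + Q.Rl 1 (f * g) s = f • Q.Rl 1 g s + Q.Rl 1 f (g • s) := by
  simpa [Finset.Nat.antidiagonal_succ, Q.Rl_zero, S'.C_zero] using Q.left_assoc_coeff f g s 1

theorem left_assoc_two :
    S'.C 2 f g • s + (Q.Rl 1 (S'.C 1 f g) s + Q.Rl 2 (f * g) s) =
      f • Q.Rl 2 g s + (Q.Rl 1 f (Q.Rl 1 g s) + Q.Rl 2 f (g • s)) := by
  simpa [Finset.Nat.antidiagonal_succ, Q.Rl_zero, S'.C_zero] using Q.left_assoc_coeff f g s 2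

theorem bimodule_coeff (N : ℕ) :
    ∑ a ∈ Finset.HasAntidiagonal.antidiagonal N, Q.Rr a.1 (Q.Rl a.2 f s) g =
      ∑ a ∈ Finset.HasAntidiagonal.antidiagonal N, Q.Rl a.1 f (Q.Rr a.2 s g) := by
  have h := congrFun (Q.bimodule (Pi.single 0 f) (Pi.single 0 s) (Pi.single 0 g)) N
  rwa [formalBilin_single_single, formalBilin_single_single, formalBilin_single_left,
    formalBilin_single_right] at h

theorem bimodule_one :
    g • Q.Rl 1 f s + Q.Rr 1 (f • s) g = f • Q.Rr 1 s g + Q.Rl 1 f (g • s) := by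
  simpa [Finset.Nat.antidiagonal_succ, Q.Rr_zero, Q.Rl_zero] using Q.bimodule_coeff f g s 1

theorem bimodule_two :
    g • Q.Rl 2 f s + (Q.Rr 1 (Q.Rl 1 f s) g + Q.Rr 2 (f • s) g) =
      f • Q.Rr 2 s g + (Q.Rl 1 f (Q.Rr 1 s g) + Q.Rl 2 f (g • s)) := by
  simpa [Finset.Nat.antidiagonal_succ, Q.Rr_zero, Q.Rl_zero] using Q.bimodule_coeff f g s 2

theorem R_mul (hC : ∀ f g, S.C 1 f g = S'.C 1 f g) :
    Q.R s (f * g) = f • Q.R s g + g • Q.R s f := by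
  have h1 := Q.right_assoc_one f g s
  have h2 := Q.left_assoc_one f g s
  have h3 := Q.bimodule_one f g s
  rw [hC] at h1
  simp only [R, smul_sub]
  linear_combination (norm := module) h1 - h2 + h3

theorem R_smul {π : PoissonTensor (SmoothFun n M)}
    (hπ : ∀ f g, S.C 1 f g - S.C 1 g f = π.bracket f g) :
    Q.R (f • s) g = f • Q.R s g + π.bracket f g • s := by
  have h1 := Q.right_assoc_one f g s
  have h2 := Q.right_assoc_one g f s
  have h3 := Q.bimodule_one g f s
  rw [mul_comm g f] at h2
  simp only [R, smul_sub, ← hπ, sub_smul]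
  linear_combination (norm := module) h2 - h1 + h3

/-- `R` as a derivation in its function argument, depending additively on the section. -/
noncomputable def derivation (hC : ∀ f g, S.C 1 f g = S'.C 1 f g) :
    SmoothSec n L →+ Derivation ℂ (SmoothFun n M) (SmoothSec n L) where
  toFun s := Derivation.mk' (Q.Rr 1 s - (Q.Rl 1).flip s) fun f g => Q.R_mul f g s hC
  map_zero' := by
    ext1 f
    simp
  map_add' s t := by
    ext1 f
    change Q.Rr 1 (s + t) f - Q.Rl 1 f (s + t) =
      Q.Rr 1 s f - Q.Rl 1 f s + (Q.Rr 1 t f - Q.Rl 1 f t)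
    rw [map_add, LinearMap.add_apply, map_add, add_sub_add_comm]

/-- In the difference of the antisymmetrized second order identities of the two actions, the
bimodule identity eliminates the operators `R₂` and `R₂'`. -/
theorem tau_smul {π : PoissonTensor (SmoothFun n M)}
    (hπ : ∀ f g, S.C 1 f g - S.C 1 g f = π.bracket f g)
    (hC : ∀ f g, S.C 1 f g = S'.C 1 f g) :
    S.tau S' f g • s =
      Q.R (Q.R s f) g - Q.R (Q.R s g) f - Q.R s (π.bracket f g) := by
  have h1 := Q.right_assoc_two f g s
  have h2 := Q.right_assoc_two g f s
  have h3 := Q.left_assoc_two f g s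
  have h4 := Q.left_assoc_two g f s
  have h5 := Q.bimodule_two f g s
  have h6 := Q.bimodule_two g f s
  rw [mul_comm g f] at h2 h4
  simp only [StarProduct.tau, R, sub_smul, ← hπ, map_sub, LinearMap.sub_apply, hC] at h1 h2 ⊢
  linear_combination (norm := module) h1 - h2 - h3 + h4 + h5 - h6

end BimoduleQuantization

end Quantization

theorem mainTheorem4 (n : ℕ) (M : Type*) [TopologicalSpace M]
    [ChartedSpace (EuclideanSpace ℝ (Fin n)) M] [IsManifold (𝓡 n) ∞ M] [T2Space M]
    [SigmaCompactSpace M]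
    (L : M → Type*) [TopologicalSpace (Bundle.TotalSpace ℂ L)]
    [∀ x, AddCommGroup (L x)] [∀ x, Module ℂ (L x)] [∀ x, TopologicalSpace (L x)]
    [FiberBundle ℂ L] [VectorBundle ℝ ℂ L] [VectorBundle ℂ ℂ L]
    [ContMDiffVectorBundle ∞ ℂ L (𝓡 n)]
    (π : PoissonTensor (SmoothFun n M)) (S S' : StarProduct n M)
    (hπ : ∀ f g, S.C 1 f g - S.C 1 g f = π.bracket f g)
    (hC : ∀ f g, S.C 1 f g = S'.C 1 f g)
    (Q : BimoduleQuantization L S S') :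
    (∃ R : ContravariantConnection π (SmoothSec n L), ∀ s f, R.D (extd f) s = Q.R s f) ∧
    ∀ R : ContravariantConnection π (SmoothSec n L), (∀ s f, R.D (extd f) s = Q.R s f) →
      ∀ (f g : SmoothFun n M) (s : SmoothSec n L),
        S.tau S' f g • s = -R.curvature (extd f) (extd g) s := by
  have := smoothSec_isReflexive (n := n) (L := L)
  refine ⟨ContravariantConnection.exists_of_derivation π (Q.derivation hC)
    fun f s g => Q.R_smul f g s hπ, fun D hD f g s => ?_⟩
  rw [Q.tau_smul f g s hπ hC, D.curvature_extd]
  simp only [hD]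
  abel
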